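/- Let $n\ge 1$ and let $A=(A_{i,j})$ be an $n\times n$ matrix with entries in $\{0,1\}$ such that for some integer $m\ge 1$ all entries of $A^m$ are strictly positive. Let $$\Sigma_A=\Big\{x=(x_0,x_1,x_2,\dots)\in\prod_{i\in\mathbf N}\{1,\dots,n\} : A_{x_i,x_{i+1}}=1\ \text{for all } i\ge 0\Big\}$$ with the topology inherited from the product topology, and let $\sigma(x_0,x_1,x_2,\dots)=(x_1,x_2,x_3,\dots)$ be the left shift on $\Sigma_A$. Fix $\beta\in(0,1)$ and put $d(x,y)=\beta^{N(x,y)}$ for $x\ne y$, where $N(x,y)$ is the largest integer $N$ such that $x_i=y_i$ for all $i<N$, and $d(x,x)=0$. Let $\phi:\Sigma_A\to\mathbf R$ be Hölder continuous, i.e. there are constants $K,\alpha>0$ with $|\phi(x)-\phi(y)|\le K\,d(x,y)^\alpha$ for all $x,y\in\Sigma_A$. Let $C(\Sigma_A)$ be the space of continuous complex functions on $\Sigma_A$ with the supremum norm, and let $\mathcal L_\phi:C(\Sigma_A)\to C(\Sigma_A)$ be Ruelle's transfer operator, $$\mathcal L_\phi(f)(x)=\sum_{y\in\sigma^{-1}(\{x\})}e^{\phi(y)}f(y),$$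 with adjoint $\mathcal L_\phi^*$ acting on the dual of $C(\Sigma_A)$. A Borel probability measure $\nu$ on $\Sigma_A$ is regarded as the element $g\mapsto\nu(g)=\int g\,d\nu$ of this dual. Then there is exactly one pair $(\lambda_1,\nu_1)$ such that $\lambda_1$ is a complex number, $\nu_1$ is a Borel probability measure on $\Sigma_A$, and $\mathcal L_\phi^*(\nu_1)=\lambda_1\nu_1$. In particular, the $\lambda$ and the $\nu$ in the conclusion of Ruelle's theorem are uniquely determined: if each of $(h,\nu,\lambda)$ and $(h',\nu',\lambda')$ is a triple consisting of a strictly positive function in $C(\Sigma_A)$, a Borel probability measure on $\Sigma_A$ and a real number $>0$ such that (stated for the first triple) $\mathcal L_\phi(h)=\lambda h$, $\mathcal L_\phi^*(\nu)=\lambda\nu$, and $\lim_{k\to\infty}\|\lambda^{-k}\mathcal L_\phi^k(g)-\nu(g)h\|=0$ for every $g\in C(\Sigma_A)$, then $\lambda=\lambda'$ and $\nu=\nu'$. -/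

import Mathlib

noncomputable section

namespace MarkovShift

open Filter Topology MeasureTheory

variable {n : ℕ}

/-- The one-sided Markov space of `A`, with the topology and the Borel `σ`-algebra inherited from
the product space of all sequences in the discrete alphabet `Fin n`. -/
def markovSpace (A : Matrix (Fin n) (Fin n) ℕ) : Set (ℕ → Fin n) :=
  {x | ∀ i, A (x i) (x (i + 1)) = 1}

variable {A : Matrix (Fin n) (Fin n) ℕ}

theorem isClosed_markovSpace : IsClosed (markovSpace A) := by
  have h : markovSpace A = ⋂ i : ℕ, {x : ℕ → Fin n | A (x i) (x (i + 1)) = 1} := by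
    ext x; simp [markovSpace]
  rw [h]
  refine isClosed_iInter fun i => ?_
  have hc : Continuous fun x : ℕ → Fin n => (x i, x (i + 1)) := by fun_prop
  exact (isClosed_discrete {q : Fin n × Fin n | A q.1 q.2 = 1}).preimage hc

instance : CompactSpace (markovSpace A) :=
  isCompact_iff_compactSpace.mp isClosed_markovSpace.isCompact

/-- The left shift `(x₀, x₁, x₂, …) ↦ (x₁, x₂, x₃, …)`. -/
def shift (A : Matrix (Fin n) (Fin n) ℕ) (x : markovSpace A) : markovSpace A :=
  ⟨fun i => x.1 (i + 1), fun i => x.2 (i + 1)⟩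

/-- The metric `d(x, y) = β ^ N(x, y)`, where `N(x, y)` is the largest `N` such that `x i = y i` for
all `i < N`, that is, the first index at which `x` and `y` differ; and `d(x, x) = 0`. -/
def shiftDist (β : ℝ) (x y : markovSpace A) : ℝ :=
  open Classical in if x = y then 0 else β ^ PiNat.firstDiff x.1 y.1

/-- Hölder continuity with respect to the metric `shiftDist β`. -/
def IsHolder (β : ℝ) (φ : markovSpace A → ℝ) : Prop :=
  ∃ K α : ℝ, 0 < K ∧ 0 < α ∧ ∀ x y, |φ x - φ y| ≤ K * shiftDist β x y ^ α

theorem tendsto_shiftDist {β : ℝ} (h0 : 0 < β) (h1 : β < 1) (x : markovSpace A) :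
    Tendsto (fun y => shiftDist β y x) (𝓝 x) (𝓝 0) := by
  rw [Metric.tendsto_nhds]
  intro ε hε
  obtain ⟨N, hN⟩ := exists_pow_lt_of_lt_one hε h1
  have hev : ∀ᶠ y : markovSpace A in 𝓝 x, ∀ i ∈ Finset.range N, y.1 i = x.1 i := by
    rw [Filter.eventually_all_finset]
    intro i _
    have hc : Continuous fun y : markovSpace A => y.1 i :=
      (continuous_apply i).comp continuous_subtype_val
    exact hc.continuousAt.eventually_mem (mem_nhds_discrete.2 (Set.mem_singleton (x.1 i)))
  filter_upwards [hev] with y hy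
  rw [Real.dist_0_eq_abs]
  by_cases hxy : y = x
  · simpa [shiftDist, hxy] using hε
  · have hne : y.1 ≠ x.1 := fun h => hxy (Subtype.ext h)
    have hle : N ≤ PiNat.firstDiff y.1 x.1 :=
      (PiNat.mem_cylinder_iff_le_firstDiff hne N).1 fun i hi => hy i (Finset.mem_range.2 hi)
    rw [shiftDist, if_neg hxy, abs_of_pos (pow_pos h0 _)]
    exact (pow_le_pow_of_le_one h0.le h1.le hle).trans_lt hN

theorem IsHolder.continuous {β : ℝ} {φ : markovSpace A → ℝ} (hφ : IsHolder β φ)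
    (h0 : 0 < β) (h1 : β < 1) : Continuous φ := by
  obtain ⟨K, α, -, hα, h⟩ := hφ
  rw [continuous_iff_continuousAt]
  intro x
  rw [ContinuousAt, tendsto_iff_dist_tendsto_zero]
  have hlim : Tendsto (fun y => K * shiftDist β y x ^ α) (𝓝 x) (𝓝 0) := by
    have := ((tendsto_shiftDist h0 h1 x).rpow_const (p := α) (Or.inr hα.le)).const_mul K
    simpa [Real.zero_rpow hα.ne'] using this
  exact squeeze_zero (fun _ => dist_nonneg) (fun y => by rw [Real.dist_eq]; exact h y x) hlim

/-- The sequence `(i, x₀, x₁, …)`. -/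
def cons (i : Fin n) (x : markovSpace A) (h : A i (x.1 0) = 1) : markovSpace A :=
  ⟨fun k => Nat.casesOn k i x.1, fun k => by cases k with
    | zero => exact h
    | succ k => exact x.2 k⟩

theorem eq_cons {x y : markovSpace A} (hy : shift A y = x) :
    ∃ h : A (y.1 0) (x.1 0) = 1, y = cons (y.1 0) x h := by
  subst hy
  refine ⟨y.2 0, Subtype.ext (funext fun k => ?_)⟩
  cases k <;> rfl

theorem injOn_fiber (x : markovSpace A) :
    Set.InjOn (fun y : markovSpace A => y.1 0) (shift A ⁻¹' {x}) := by
  intro y hy z hz hyz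
  obtain ⟨h1, e1⟩ := eq_cons hy
  obtain ⟨h2, e2⟩ := eq_cons hz
  rw [e1, e2]
  congr 1

theorem finite_fiber (x : markovSpace A) : (shift A ⁻¹' {x}).Finite :=
  Set.Finite.of_finite_image (Set.toFinite _) (injOn_fiber x)

/-- The sum of `f` over the finite fiber `σ⁻¹({x})`. -/
def fiberSum (f : markovSpace A → ℂ) (x : markovSpace A) : ℂ :=
  ∑ y ∈ (finite_fiber x).toFinset, f y

theorem fiberSum_eq (f : markovSpace A → ℂ) (x : markovSpace A) :
    fiberSum f x = ∑ i : Fin n, if h : A i (x.1 0) = 1 then f (cons i x h) else 0 := by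
  classical
  have hs : ∑ i : Fin n, (if h : A i (x.1 0) = 1 then f (cons i x h) else 0) =
      ∑ i ∈ Finset.univ.filter (fun i => A i (x.1 0) = 1),
        (if h : A i (x.1 0) = 1 then f (cons i x h) else 0) := by
    rw [Finset.sum_filter]
    refine Finset.sum_congr rfl fun i _ => ?_
    split_ifs <;> rfl
  rw [hs, fiberSum]
  refine Finset.sum_bij (fun y _ => y.1 0) ?_ ?_ ?_ ?_
  · intro y hy
    have hy' : shift A y = x := by simpa using hy
    simpa using (eq_cons hy').1
  · intro y hy z hz h
    exact injOn_fiber x (by simpa using hy) (by simpa using hz) h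
  · intro i hi
    have hi' : A i (x.1 0) = 1 := by simpa using hi
    exact ⟨cons i x hi', (finite_fiber x).mem_toFinset.2 (rfl : shift A (cons i x hi') = x), rfl⟩
  · intro y hy
    have hy' : shift A y = x := by simpa using hy
    obtain ⟨h, e⟩ := eq_cons hy'
    rw [dif_pos h, ← e]

theorem continuous_fiberSum (f : C(markovSpace A, ℂ)) : Continuous (fiberSum f) := by
  have he : fiberSum (f : markovSpace A → ℂ) = fun x => ∑ i : Fin n,
      if h : A i (x.1 0) = 1 then f (cons i x h) else 0 := funext (fiberSum_eq f)
  rw [he]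
  refine continuous_finsetSum _ fun i _ => ?_
  have hc : Continuous fun x : markovSpace A => x.1 0 :=
    (continuous_apply 0).comp continuous_subtype_val
  have hS : IsClopen {x : markovSpace A | A i (x.1 0) = 1} :=
    (isClopen_discrete {j : Fin n | A i j = 1}).preimage hc
  rw [← continuousOn_univ, ← Set.union_compl_self {x : markovSpace A | A i (x.1 0) = 1}]
  refine ContinuousOn.union_of_isOpen ?_ ?_ hS.isOpen hS.compl.isOpen
  · rw [continuousOn_iff_continuous_domRestrict]
    have hr : Set.domRestrict {x : markovSpace A | A i (x.1 0) = 1}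
        (fun x => if h : A i (x.1 0) = 1 then f (cons i x h) else 0) =
        fun x => f (cons i x.1 x.2) := by
      funext x
      exact dif_pos x.2
    refine hr ▸ f.continuous.comp (Continuous.subtype_mk (continuous_pi fun k => ?_) _)
    cases k with
    | zero => exact continuous_const
    | succ k => exact (continuous_apply k).comp (continuous_subtype_val.comp continuous_subtype_val)
  · refine (continuousOn_const (c := (0 : ℂ))).congr fun x hx => ?_
    exact dif_neg hx

theorem norm_fiberSum_le (f : C(markovSpace A, ℂ)) (x : markovSpace A) :
    ‖fiberSum f x‖ ≤ n * ‖f‖ := by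
  rw [fiberSum_eq]
  refine (norm_sum_le _ _).trans ?_
  refine (Finset.sum_le_card_nsmul _ _ ‖f‖ fun i _ => ?_).trans (by simp)
  split_ifs
  · exact f.norm_coe_le_norm _
  · simp

/-- The transfer operator `(L f)(x) = ∑ f(y)`, the sum over `y ∈ σ⁻¹({x})`, on `C(Σ_A)`. -/
def transfer (A : Matrix (Fin n) (Fin n) ℕ) : C(markovSpace A, ℂ) →L[ℂ] C(markovSpace A, ℂ) :=
  LinearMap.mkContinuous
    { toFun := fun f => ⟨fiberSum f, continuous_fiberSum f⟩
      map_add' := fun f g => by ext x; simp [fiberSum, Finset.sum_add_distrib]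
      map_smul' := fun c f => by ext x; simp [fiberSum, Finset.mul_sum] }
    n fun f => (ContinuousMap.norm_le _ (by positivity)).2 (norm_fiberSum_le f)

/-- The function `e^φ` as an element of `C(Σ_A)`. -/
def expFun (φ : C(markovSpace A, ℝ)) : C(markovSpace A, ℂ) :=
  ⟨fun x => (Real.exp (φ x) : ℂ), by fun_prop⟩

/-- Ruelle's transfer operator `L_φ(f) = L(e^φ f)`. -/
def ruelleOp (φ : C(markovSpace A, ℝ)) : C(markovSpace A, ℂ) →L[ℂ] C(markovSpace A, ℂ) :=
  (transfer A).comp (ContinuousLinearMap.mul ℂ C(markovSpace A, ℂ) (expFun φ))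

/-- The adjoint `L_φ^*` of Ruelle's transfer operator, on the dual of `C(Σ_A)`. -/
def ruelleAdj (φ : C(markovSpace A, ℝ)) :
    StrongDual ℂ C(markovSpace A, ℂ) →L[ℂ] StrongDual ℂ C(markovSpace A, ℂ) :=
  ContinuousLinearMap.precomp ℂ (ruelleOp φ)

theorem integrable_continuousMap (ν : ProbabilityMeasure (markovSpace A))
    (f : C(markovSpace A, ℂ)) : Integrable f (ν : Measure (markovSpace A)) :=
  f.continuous.integrable_of_hasCompactSupport (HasCompactSupport.of_compactSpace f)

/-- A Borel probability measure `ν` as the element `g ↦ ∫ g dν` of the dual of `C(Σ_A)`. -/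
def functional (ν : ProbabilityMeasure (markovSpace A)) : StrongDual ℂ C(markovSpace A, ℂ) :=
  LinearMap.mkContinuous
    { toFun := fun f => ∫ x, f x ∂(ν : Measure (markovSpace A))
      map_add' := fun f g =>
        integral_add (integrable_continuousMap ν f) (integrable_continuousMap ν g)
      map_smul' := fun c f => integral_const_mul c _ }
    1 fun f => by
      have h := norm_integral_le_of_norm_le_const (μ := (ν : Measure (markovSpace A)))
        (Eventually.of_forall fun x => f.norm_coe_le_norm x)
      simpa using h

/-- The conclusion of Ruelle's theorem for `φ`: `h` is strictly positive, `lam > 0`,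
`L_φ h = lam h`, `L_φ^* ν = lam ν`, and `lam⁻ᵏ L_φᵏ g → ν(g) h` uniformly for every `g`. -/
structure IsRuelleTriple (φ : C(markovSpace A, ℝ)) (h : C(markovSpace A, ℂ))
    (ν : ProbabilityMeasure (markovSpace A)) (lam : ℝ) : Prop where
  h_pos : ∀ x, 0 < (h x).re ∧ (h x).im = 0
  lam_pos : 0 < lam
  eigenfunction : ruelleOp φ h = (lam : ℂ) • h
  eigenmeasure : ruelleAdj φ (functional ν) = (lam : ℂ) • functional ν
  convergence : ∀ g : C(markovSpace A, ℂ),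
    Tendsto (fun k : ℕ => ‖((lam : ℂ) ^ k)⁻¹ • (ruelleOp φ ^ k) g - functional ν g • h‖)
      atTop (𝓝 0)

end MarkovShift

end

open MarkovShift MeasureTheory

/-! Write `T` for the transfer operator on real functions. The core is that `T^k g / T^k 1`
converges uniformly to a constant `ratio g`, for every continuous `g`. This gives existence and
uniqueness together, with no fixed point theorem and no eigenfunction. Existence: `ratio` is linear,
positive, sends `1` to `1`, and satisfies `ratio (T g) = ratio (T 1) * ratio g`, so its Riesz
measure is an eigenmeasure. Uniqueness: integrating the convergence against any eigenmeasure `ν` and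
dividing by the power of its eigenvalue forces `∫ g dν = ratio g`; the eigenvalue is then `∫ T 1
dν`. Convergence (`exists_eventual_ratio`) is a contraction argument needing only positivity, `T 1`
bounded below, and the property `mixing`. For the shift (`isMixing_realOp`), mixing combines bounded
distortion, from the summable variations of a Hölder potential, with positivity of `A^m`, which
joins any symbol to any other in `m` steps. -/

namespace MarkovShift

/-! ### Convergence of ratios for an abstract mixing positive operator -/

section PositiveOperator

variable {X : Type*} [TopologicalSpace X]

/-- A positive operator `T` for which `T^(j+m) f` at any point dominates `T^j f` at any other point,
up to an error that is small compared to `T^j 1`. -/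
structure IsMixing (T : C(X, ℝ) →ₗ[ℝ] C(X, ℝ)) : Prop where
  nonneg : ∀ f, 0 ≤ f → 0 ≤ T f
  one_lower : ∃ p : ℝ, 0 < p ∧ p • (1 : C(X, ℝ)) ≤ T 1
  mixing : ∃ m : ℕ, ∃ c : ℝ, 0 < c ∧ ∀ f : C(X, ℝ), 0 ≤ f → ∀ η : ℝ, 0 < η →
    ∃ J : ℕ, ∀ j ≥ J, ∀ x y, c * ((T ^ j) f y - η * (T ^ j) 1 y) ≤ (T ^ (j + m)) f x

variable {T : C(X, ℝ) →ₗ[ℝ] C(X, ℝ)}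

namespace IsMixing

theorem pow_mono (hT : IsMixing T) (k : ℕ) {f g : C(X, ℝ)} (h : f ≤ g) : (T ^ k) f ≤ (T ^ k) g := by
  induction k generalizing f g with
  | zero => simpa using h
  | succ k ih =>
    rw [pow_succ, Module.End.mul_apply, Module.End.mul_apply]
    refine ih ?_
    have := hT.nonneg (g - f) (sub_nonneg.2 h)
    rwa [map_sub, sub_nonneg] at this

theorem pow_add_apply (j k : ℕ) (f : C(X, ℝ)) : (T ^ (j + k)) f = (T ^ j) ((T ^ k) f) := by
  rw [pow_add, Module.End.mul_apply]

theorem exists_smul_one_le_pow (hT : IsMixing T) (k : ℕ) :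
    ∃ p : ℝ, 0 < p ∧ p • (1 : C(X, ℝ)) ≤ (T ^ k) 1 := by
  obtain ⟨p, hp, h1⟩ := hT.one_lower
  refine ⟨p ^ k, pow_pos hp k, ?_⟩
  induction k with
  | zero => simp
  | succ k ih =>
    rw [pow_add_apply, pow_one]
    have h2 := hT.pow_mono k h1
    rw [map_smul] at h2
    refine le_trans ?_ h2
    rw [pow_succ', mul_smul]
    exact smul_le_smul_of_nonneg_left ih hp.le

theorem pow_one_pos (hT : IsMixing T) (k : ℕ) (x : X) : 0 < (T ^ k) 1 x := by
  obtain ⟨p, hp, h⟩ := hT.exists_smul_one_le_pow k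
  have h1 : p * 1 ≤ (T ^ k) 1 x := h x
  linarith

theorem lower_mono (hT : IsMixing T) {t : ℝ} {g : C(X, ℝ)} {k l : ℕ} (hkl : k ≤ l)
    (h : t • (T ^ k) 1 ≤ (T ^ k) g) : t • (T ^ l) 1 ≤ (T ^ l) g := by
  obtain ⟨i, rfl⟩ := Nat.exists_eq_add_of_le' hkl
  rw [pow_add_apply, pow_add_apply, ← map_smul]
  exact hT.pow_mono i h

theorem upper_mono (hT : IsMixing T) {t : ℝ} {g : C(X, ℝ)} {k l : ℕ} (hkl : k ≤ l)
    (h : (T ^ k) g ≤ t • (T ^ k) 1) : (T ^ l) g ≤ t • (T ^ l) 1 := by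
  obtain ⟨i, rfl⟩ := Nat.exists_eq_add_of_le' hkl
  rw [pow_add_apply, pow_add_apply, ← map_smul]
  exact hT.pow_mono i h

variable [CompactSpace X]

/-- Mixing at time `i` bounds the whole function `T^i 1` by a multiple of the single value `T^(i+m)
1 y`. Applying `T^(2m)` costs only the norm of `T^(2m) 1`. -/
theorem exists_pow_one_comparison (hT : IsMixing T) {m : ℕ} {c : ℝ} (hc : 0 < c)
    (H : ∃ J : ℕ, ∀ j ≥ J, ∀ x y, c * ((T ^ j) 1 y - 1 / 2 * (T ^ j) 1 y) ≤ (T ^ (j + m)) 1 x) :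
    ∃ d : ℝ, 0 < d ∧ ∃ J : ℕ, ∀ j ≥ J, ∀ x y, d * (T ^ (j + m)) 1 x ≤ (T ^ j) 1 y := by
  obtain ⟨J, hJ⟩ := H
  set B := ‖(T ^ (2 * m)) 1‖ + 1 with hB
  have hB0 : 0 < B := by positivity
  refine ⟨c / (2 * B), by positivity, J + m, fun j hj x y => ?_⟩
  obtain ⟨i, rfl⟩ := Nat.exists_eq_add_of_le' (show m ≤ j by omega)
  set s := 2 / c * (T ^ (i + m)) 1 y with hs
  have hs0 : 0 < s := mul_pos (by positivity) (hT.pow_one_pos _ _)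
  have h1 : (T ^ i) 1 ≤ s • (1 : C(X, ℝ)) := fun z => by
    have := hJ i (by omega) y z
    change (T ^ i) 1 z ≤ s * 1
    rw [mul_one, hs, div_mul_eq_mul_div, le_div_iff₀ hc]
    linarith
  have h2 := hT.pow_mono (2 * m) h1
  rw [← pow_add_apply, map_smul] at h2
  replace h2 : (T ^ (2 * m + i)) 1 x ≤ s * (T ^ (2 * m)) 1 x := h2 x
  have h3 : (T ^ (2 * m)) 1 x ≤ B :=
    ((le_abs_self _).trans (((T ^ (2 * m)) 1).norm_coe_le_norm x)).trans (by linarith)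
  have h4 : (T ^ (i + m + m)) 1 x ≤ s * B := by
    rw [show i + m + m = 2 * m + i by ring]
    exact h2.trans (mul_le_mul_of_nonneg_left h3 hs0.le)
  calc c / (2 * B) * (T ^ (i + m + m)) 1 x ≤ c / (2 * B) * (s * B) := by gcongr
    _ = _ := by rw [hs]; field_simp

/-- Bounds of `T^k g` by multiples of `T^k 1` persist under `T`, so it suffices that the best lower
constant `a` and the best upper constant `b` agree. If `a < b`, then `T^k g - t • T^k 1` is large
somewhere at every later time; mixing spreads this to all points and raises the lower constant past
`a`. -/
theorem exists_eventual_ratio [Nonempty X] (hT : IsMixing T) (g : C(X, ℝ)) :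
    ∃ l : ℝ, ∀ ε > 0, ∃ k₀, ∀ k ≥ k₀,
      (l - ε) • (T ^ k) 1 ≤ (T ^ k) g ∧ (T ^ k) g ≤ (l + ε) • (T ^ k) 1 := by
  set S : Set ℝ := {t | ∃ k, t • (T ^ k) 1 ≤ (T ^ k) g} with hS
  set U : Set ℝ := {t | ∃ k, (T ^ k) g ≤ t • (T ^ k) 1} with hU
  have hSU : ∀ t ∈ S, ∀ s ∈ U, t ≤ s := by
    rintro t ⟨k, hk⟩ s ⟨l, hl⟩
    obtain ⟨x⟩ := ‹Nonempty X›
    have h1 := hT.lower_mono (le_max_left k l) hk x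
    have h2 := hT.upper_mono (le_max_right k l) hl x
    exact le_of_mul_le_mul_right (h1.trans h2) (hT.pow_one_pos _ x)
  have hSne : -‖g‖ ∈ S := ⟨0, fun x => by
    simpa using neg_le_of_abs_le (g.norm_coe_le_norm x)⟩
  have hUne : ‖g‖ ∈ U := ⟨0, fun x => by
    simpa using le_of_abs_le (g.norm_coe_le_norm x)⟩
  have hSb : BddAbove S := ⟨_, fun t ht => hSU t ht _ hUne⟩
  have hUb : BddBelow U := ⟨_, fun s hs => hSU _ hSne s hs⟩
  have hba : sInf U ≤ sSup S := by
    by_contra! hlt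
    set a := sSup S with ha
    set b := sInf U with hb
    obtain ⟨m, c, hc, H⟩ := hT.mixing
    obtain ⟨d, hd, J₂, hJ₂⟩ := hT.exists_pow_one_comparison hc
      (H 1 zero_le_one (1 / 2) (by norm_num))
    have hδ : 0 < b - a := sub_pos.2 hlt
    have hq : 0 < c * d := mul_pos hc hd
    -- The deficit allowed for `t` is the gain `c * d * (b - a) / 2` obtained below.
    obtain ⟨t, ⟨k, hk⟩, hta⟩ := exists_lt_of_lt_csSup ⟨_, hSne⟩
      (show a - c * d * (b - a) / 2 < a by linarith [mul_pos hq hδ])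
    have hta' : t ≤ a := le_csSup hSb ⟨k, hk⟩
    set s := b - (b - a) / 4 with hs
    have hsU : s ∉ U := fun h => absurd (csInf_le hUb h) (by linarith)
    obtain ⟨p, hp, hpk⟩ := hT.exists_smul_one_le_pow k
    -- With this `η`, the mixing error `η * T^j 1` is at most `(b - a) / 4 * T^(j+k) 1`, because `p
    -- ≤ T^k 1`.
    obtain ⟨J₁, hJ₁⟩ := H ((T ^ k) g - t • (T ^ k) 1) (sub_nonneg.2 hk)
      ((b - a) / 4 * p) (by positivity)
    set j := max J₁ J₂ with hj
    have hy : ∃ y, s * (T ^ (j + k)) 1 y < (T ^ (j + k)) g y := by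
      by_contra! hcon
      exact hsU ⟨j + k, fun y => hcon y⟩
    obtain ⟨y, hy⟩ := hy
    -- Here `s - t - (b - a) / 4 ≥ (b - a) / 2` since `t ≤ a`, so this element of `S` exceeds `a`.
    have hmem : t + c * d * (s - t - (b - a) / 4) ∈ S := by
      refine ⟨j + m + k, fun x => ?_⟩
      have h1 := hJ₁ j (le_max_left _ _) x y
      have h2 := hJ₂ (j + k) (by omega) x y
      have h3 := hT.pow_mono j hpk
      simp only [map_sub, map_smul, ← pow_add_apply, ContinuousMap.coe_sub, Pi.sub_apply,
        ContinuousMap.coe_smul, Pi.smul_apply, smul_eq_mul] at h1 h3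
      replace h3 : p * (T ^ j) 1 y ≤ (T ^ (j + k)) 1 y := h3 y
      change (t + c * d * (s - t - (b - a) / 4)) * (T ^ (j + m + k)) 1 x ≤ (T ^ (j + m + k)) g x
      rw [show j + k + m = j + m + k by ring] at h2
      have hw : 0 < s - t - (b - a) / 4 := by linarith
      have h4 : (s - t - (b - a) / 4) * (T ^ (j + k)) 1 y ≤
          (T ^ (j + k)) g y - t * (T ^ (j + k)) 1 y - (b - a) / 4 * p * (T ^ j) 1 y := by
        have := mul_le_mul_of_nonneg_left h3 (show 0 ≤ (b - a) / 4 by positivity)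
        linarith
      have h5 := mul_le_mul_of_nonneg_left h2 (mul_pos hc hw).le
      have h6 := mul_le_mul_of_nonneg_left h4 hc.le
      linarith
    have := le_csSup hSb hmem
    have h7 : c * d * ((b - a) / 2) ≤ c * d * (s - t - (b - a) / 4) :=
      mul_le_mul_of_nonneg_left (by linarith) hq.le
    linarith
  refine ⟨sSup S, fun ε hε => ?_⟩
  obtain ⟨t, ⟨k, hk⟩, ht⟩ := exists_lt_of_lt_csSup ⟨_, hSne⟩ (show sSup S - ε < sSup S by linarith)
  obtain ⟨s, ⟨l, hl⟩, hs⟩ := exists_lt_of_csInf_lt ⟨_, hUne⟩ (show sInf U < sSup S + ε by linarith)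
  refine ⟨max k l, fun i hi => ⟨fun x => ?_, fun x => ?_⟩⟩
  · have h1 := hT.lower_mono (le_of_max_le_left hi) hk x
    exact (mul_le_mul_of_nonneg_right ht.le (hT.pow_one_pos i x).le).trans h1
  · have h1 := hT.upper_mono (le_of_max_le_right hi) hl x
    exact h1.trans (mul_le_mul_of_nonneg_right hs.le (hT.pow_one_pos i x).le)

/-! ### The limit ratio as a positive normalized functional -/

variable [Nonempty X]

/-- The uniform limit of `T^k g / T^k 1`. -/
noncomputable def ratio (hT : IsMixing T) (g : C(X, ℝ)) : ℝ := (hT.exists_eventual_ratio g).choose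

theorem ratio_spec (hT : IsMixing T) (g : C(X, ℝ)) {ε : ℝ} (hε : 0 < ε) :
    ∃ k₀, ∀ k ≥ k₀, ∀ x, |(T ^ k) g x - hT.ratio g * (T ^ k) 1 x| ≤ ε * (T ^ k) 1 x := by
  obtain ⟨k₀, h⟩ := (hT.exists_eventual_ratio g).choose_spec ε hε
  refine ⟨k₀, fun k hk x => ?_⟩
  have h1 : (hT.ratio g - ε) * (T ^ k) 1 x ≤ (T ^ k) g x := (h k hk).1 x
  have h2 : (T ^ k) g x ≤ (hT.ratio g + ε) * (T ^ k) 1 x := (h k hk).2 x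
  rw [abs_le]
  constructor <;> linarith

theorem ratio_eq_of_forall (hT : IsMixing T) {g : C(X, ℝ)} {l : ℝ}
    (h : ∀ ε > 0, ∃ k₀, ∀ k ≥ k₀, ∀ x, |(T ^ k) g x - l * (T ^ k) 1 x| ≤ ε * (T ^ k) 1 x) :
    hT.ratio g = l := by
  refine eq_of_forall_dist_le fun ε hε => ?_
  obtain ⟨k₁, h1⟩ := h (ε / 2) (by positivity)
  obtain ⟨k₂, h2⟩ := hT.ratio_spec g (ε := ε / 2) (by positivity)
  obtain ⟨x⟩ := ‹Nonempty X›
  have e1 := h1 (max k₁ k₂) (le_max_left _ _) x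
  have e2 := h2 (max k₁ k₂) (le_max_right _ _) x
  have hp := hT.pow_one_pos (max k₁ k₂) x
  refine le_of_mul_le_mul_right ?_ hp
  rw [Real.dist_eq, ← abs_of_pos hp, ← abs_mul, abs_of_pos hp]
  rw [abs_le] at e1 e2 ⊢
  constructor <;> linarith

theorem ratio_add (hT : IsMixing T) (f g : C(X, ℝ)) :
    hT.ratio (f + g) = hT.ratio f + hT.ratio g := by
  refine hT.ratio_eq_of_forall fun ε hε => ?_
  obtain ⟨k₁, h1⟩ := hT.ratio_spec f (ε := ε / 2) (by positivity)
  obtain ⟨k₂, h2⟩ := hT.ratio_spec g (ε := ε / 2) (by positivity)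
  refine ⟨max k₁ k₂, fun k hk x => ?_⟩
  have e1 := h1 k (le_of_max_le_left hk) x
  have e2 := h2 k (le_of_max_le_right hk) x
  rw [map_add, ContinuousMap.add_apply]
  rw [abs_le] at e1 e2 ⊢
  constructor <;> linarith

theorem ratio_smul (hT : IsMixing T) (r : ℝ) (g : C(X, ℝ)) :
    hT.ratio (r • g) = r * hT.ratio g := by
  refine hT.ratio_eq_of_forall fun ε hε => ?_
  obtain ⟨k₁, h1⟩ := hT.ratio_spec g (ε := ε / (|r| + 1)) (by positivity)
  refine ⟨k₁, fun k hk x => ?_⟩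
  have e1 := h1 k hk x
  rw [map_smul, ContinuousMap.smul_apply, smul_eq_mul, mul_assoc, ← mul_sub, abs_mul]
  have hp := hT.pow_one_pos k x
  calc |r| * |(T ^ k) g x - hT.ratio g * (T ^ k) 1 x|
      ≤ (|r| + 1) * (ε / (|r| + 1) * (T ^ k) 1 x) :=
        mul_le_mul (by linarith) e1 (abs_nonneg _) (by positivity)
    _ = _ := by field_simp

theorem ratio_nonneg (hT : IsMixing T) {g : C(X, ℝ)} (hg : 0 ≤ g) : 0 ≤ hT.ratio g := by
  refine le_of_forall_pos_le_add fun ε hε => ?_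
  obtain ⟨k, h⟩ := hT.ratio_spec g hε
  obtain ⟨x⟩ := ‹Nonempty X›
  have h1 := (abs_le.1 (h k le_rfl x)).2
  have h2 := hT.pow_mono k hg
  rw [map_zero] at h2
  replace h2 : 0 ≤ (T ^ k) g x := h2 x
  exact le_of_mul_le_mul_right (by linarith) (hT.pow_one_pos k x)

theorem ratio_one (hT : IsMixing T) : hT.ratio 1 = 1 :=
  hT.ratio_eq_of_forall fun ε hε => ⟨0, fun k _ x => by
    simpa using mul_nonneg hε.le (hT.pow_one_pos k x).le⟩

/-- Read `T^(k+1) g` in two ways: it is close to `ratio g` times `T^k (T 1)`, which is itself close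
to `ratio (T 1)` times `T^k 1`. -/
theorem ratio_apply_operator (hT : IsMixing T) (g : C(X, ℝ)) :
    hT.ratio (T g) = hT.ratio (T 1) * hT.ratio g := by
  refine hT.ratio_eq_of_forall fun ε hε => ?_
  set B := |hT.ratio (T 1)| + |hT.ratio g| + 1 with hB
  have hB0 : 0 < B := by positivity
  -- The cap `δ ≤ 1` gives `ratio (T 1) + δ ≤ B`, hence `Q ≤ B * P` below.
  set δ := min (ε / (2 * B)) 1 with hδ
  have hδ0 : 0 < δ := lt_min (by positivity) one_pos
  have hδ1 : δ ≤ 1 := min_le_right _ _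
  have hδB : 2 * (δ * B) ≤ ε := by
    have := mul_le_mul_of_nonneg_right (min_le_left (ε / (2 * B)) 1) (mul_pos two_pos hB0).le
    rw [div_mul_cancel₀ _ (by positivity)] at this
    linarith
  obtain ⟨k₁, h1⟩ := hT.ratio_spec g hδ0
  obtain ⟨k₂, h2⟩ := hT.ratio_spec (T 1) hδ0
  refine ⟨max k₁ k₂, fun k hk x => ?_⟩
  have e1 := h1 (k + 1) (by omega) x
  have e2 := h2 k (le_of_max_le_right hk) x
  rw [pow_add_apply, pow_add_apply, pow_one] at e1
  have hp := hT.pow_one_pos k x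
  set P := (T ^ k) 1 x
  set Q := (T ^ k) (T 1) x
  set a := hT.ratio (T 1)
  set l := hT.ratio g
  have hQ : Q ≤ B * P := by
    have := (abs_le.1 e2).2
    have h3 : (a + δ) * P ≤ B * P :=
      mul_le_mul_of_nonneg_right (by linarith [le_abs_self a, abs_nonneg l]) hp.le
    linarith
  calc |(T ^ k) (T g) x - a * l * P|
      = |((T ^ k) (T g) x - l * Q) + l * (Q - a * P)| := by ring_nf
    _ ≤ δ * Q + |l| * (δ * P) := by
        refine (abs_add_le _ _).trans (add_le_add e1 ?_)
        rw [abs_mul]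
        exact mul_le_mul_of_nonneg_left e2 (abs_nonneg _)
    _ ≤ δ * (B * P) + B * (δ * P) := by
        refine add_le_add (mul_le_mul_of_nonneg_left hQ hδ0.le)
          (mul_le_mul_of_nonneg_right (by linarith [abs_nonneg a]) (by positivity))
    _ = 2 * (δ * B) * P := by ring
    _ ≤ ε * P := mul_le_mul_of_nonneg_right hδB hp.le

end IsMixing

end PositiveOperator

end MarkovShift

/-! ### Mixing of the transfer operator on the Markov space -/

noncomputable section

namespace MarkovShift

open Filter Topology MeasureTheory

variable {n : ℕ} {A : Matrix (Fin n) (Fin n) ℕ}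

/-- A real continuous function as a complex one. -/
def toComplex (g : C(markovSpace A, ℝ)) : C(markovSpace A, ℂ) := ⟨fun x => (g x : ℂ), by fun_prop⟩

theorem ruelleOp_toComplex_apply (φ g : C(markovSpace A, ℝ)) (x : markovSpace A) :
    ruelleOp φ (toComplex g) x = ((∑ i : Fin n, if h : A i (x.1 0) = 1 then
      Real.exp (φ (cons i x h)) * g (cons i x h) else 0 : ℝ) : ℂ) := by
  change fiberSum (fun y => ((Real.exp (φ y) : ℝ) : ℂ) * ((g y : ℝ) : ℂ)) x = _
  rw [fiberSum_eq, Complex.ofReal_sum]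
  refine Finset.sum_congr rfl fun i _ => ?_
  split_ifs <;> simp

/-- Ruelle's transfer operator on real functions. -/
def realOp (φ : C(markovSpace A, ℝ)) : C(markovSpace A, ℝ) →ₗ[ℝ] C(markovSpace A, ℝ) where
  toFun g := ⟨fun x => (ruelleOp φ (toComplex g) x).re, by fun_prop⟩
  map_add' f g := by
    have : toComplex (f + g) = toComplex f + toComplex g := by ext x; simp [toComplex]
    ext x
    simp [this]
  map_smul' r g := by
    have : toComplex (r • g) = (r : ℂ) • toComplex g := by ext x; simp [toComplex]
    ext x
    simp [this]

theorem realOp_apply (φ g : C(markovSpace A, ℝ)) (x : markovSpace A) :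
    realOp φ g x = ∑ i : Fin n, if h : A i (x.1 0) = 1 then
      Real.exp (φ (cons i x h)) * g (cons i x h) else 0 := by
  change (ruelleOp φ (toComplex g) x).re = _
  rw [ruelleOp_toComplex_apply, Complex.ofReal_re]

theorem ruelleOp_toComplex (φ g : C(markovSpace A, ℝ)) :
    ruelleOp φ (toComplex g) = toComplex (realOp φ g) := by
  ext x
  rw [ruelleOp_toComplex_apply, ← realOp_apply]
  rfl

theorem realOp_nonneg (φ g : C(markovSpace A, ℝ)) (hg : 0 ≤ g) : 0 ≤ realOp φ g := fun x => by
  change 0 ≤ realOp φ g x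
  rw [realOp_apply]
  refine Finset.sum_nonneg fun i _ => ?_
  split_ifs
  · exact mul_nonneg (Real.exp_pos _).le (hg _)
  · exact le_rfl

theorem exp_mul_le_realOp (φ g : C(markovSpace A, ℝ)) (hg : 0 ≤ g) (x : markovSpace A) (i : Fin n)
    (h : A i (x.1 0) = 1) : Real.exp (-‖φ‖) * g (cons i x h) ≤ realOp φ g x := by
  rw [realOp_apply]
  have h1 := Finset.single_le_sum (f := fun i : Fin n => if h : A i (x.1 0) = 1 then
      Real.exp (φ (cons i x h)) * g (cons i x h) else 0) (s := Finset.univ) (fun i _ => by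
        split_ifs
        · exact mul_nonneg (Real.exp_pos _).le (hg _)
        · exact le_rfl) (Finset.mem_univ i)
  refine le_trans ?_ h1
  rw [dif_pos h]
  exact mul_le_mul_of_nonneg_right
    (Real.exp_le_exp.2 (neg_le_of_abs_le (φ.norm_coe_le_norm _))) (hg _)

theorem realOp_pow_nonneg (φ g : C(markovSpace A, ℝ)) (hg : 0 ≤ g) (k : ℕ) :
    0 ≤ (realOp φ ^ k) g := by
  induction k with
  | zero => simpa using hg
  | succ k ih =>
    rw [pow_succ', Module.End.mul_apply]
    exact realOp_nonneg φ _ ih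

/-- All terms of `T^m g x` are nonnegative, so one may keep only the preimage obtained by prepending
an admissible path of length `m` from `i` to `x 0`. -/
theorem exists_mul_le_realOp_pow (hA : ∀ i j, A i j = 0 ∨ A i j = 1) (φ g : C(markovSpace A, ℝ))
    (hg : 0 ≤ g) (m : ℕ) (i : Fin n) (x : markovSpace A) (h : 0 < (A ^ m) i (x.1 0)) :
    ∃ z : markovSpace A, z.1 0 = i ∧ Real.exp (-‖φ‖) ^ m * g z ≤ (realOp φ ^ m) g x := by
  induction m generalizing x with
  | zero =>
    refine ⟨x, ?_, by simp⟩
    by_contra hne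
    simp [Matrix.one_apply_ne (Ne.symm hne)] at h
  | succ m ih =>
    rw [pow_succ, Matrix.mul_apply] at h
    obtain ⟨k, -, hk⟩ := Finset.exists_ne_zero_of_sum_ne_zero h.ne'
    have h1 : A k (x.1 0) = 1 := (hA _ _).resolve_left (right_ne_zero_of_mul hk)
    obtain ⟨z, hz, hle⟩ := ih (cons k x h1) (Nat.pos_of_ne_zero (left_ne_zero_of_mul hk))
    refine ⟨z, hz, ?_⟩
    rw [pow_succ', pow_succ', Module.End.mul_apply, mul_assoc]
    exact (mul_le_mul_of_nonneg_left hle (Real.exp_pos _).le).trans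
      (exp_mul_le_realOp φ _ (realOp_pow_nonneg φ g hg m) x k h1)

theorem exists_predecessor (hA : ∀ i j, A i j = 0 ∨ A i j = 1)
    (hpos : ∃ m : ℕ, 0 < m ∧ ∀ i j, 0 < (A ^ m) i j) (j : Fin n) : ∃ i, A i j = 1 := by
  obtain ⟨m, hm, h⟩ := hpos
  obtain ⟨m, rfl⟩ := Nat.exists_eq_add_of_le' hm
  have := h j j
  rw [pow_succ, Matrix.mul_apply] at this
  obtain ⟨k, -, hk⟩ := Finset.exists_ne_zero_of_sum_ne_zero this.ne'
  exact ⟨k, (hA _ _).resolve_left (right_ne_zero_of_mul hk)⟩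

theorem exists_successor (hA : ∀ i j, A i j = 0 ∨ A i j = 1)
    (hpos : ∃ m : ℕ, 0 < m ∧ ∀ i j, 0 < (A ^ m) i j) (i : Fin n) : ∃ j, A i j = 1 := by
  obtain ⟨m, hm, h⟩ := hpos
  obtain ⟨m, rfl⟩ := Nat.exists_eq_add_of_le' hm
  have := h i i
  rw [pow_succ', Matrix.mul_apply] at this
  obtain ⟨k, -, hk⟩ := Finset.exists_ne_zero_of_sum_ne_zero this.ne'
  exact ⟨k, (hA _ _).resolve_left (left_ne_zero_of_mul hk)⟩

theorem nonempty_markovSpace (hn : 0 < n) (h : ∀ i, ∃ j, A i j = 1) : Nonempty (markovSpace A) := by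
  choose s hs using h
  exact ⟨⟨fun k => s^[k] ⟨0, hn⟩, fun k => by
    change A (s^[k] ⟨0, hn⟩) (s^[k + 1] ⟨0, hn⟩) = 1
    rw [Function.iterate_succ_apply']
    exact hs _⟩⟩

/-- Uniform continuity by compactness: the pairs violating the bound at depth `J` form decreasing
closed sets, and a common point would lie on the diagonal. -/
theorem exists_le_add_of_agree (f : C(markovSpace A, ℝ)) {η : ℝ} (hη : 0 < η) :
    ∃ J : ℕ, ∀ x y : markovSpace A, (∀ i < J, x.1 i = y.1 i) → f x ≤ f y + η := by
  by_contra! hcon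
  let D : ℕ → Set (markovSpace A × markovSpace A) := fun J =>
    {q | (∀ i < J, q.1.1 i = q.2.1 i) ∧ f q.2 + η ≤ f q.1}
  have hclosed : ∀ J, IsClosed (D J) := fun J => by
    refine IsClosed.inter ?_ (isClosed_le
      ((f.continuous.comp continuous_snd).add continuous_const) (f.continuous.comp continuous_fst))
    have : {q : markovSpace A × markovSpace A | ∀ i < J, q.1.1 i = q.2.1 i} =
        ⋂ i, ⋂ (_ : i < J), {q | q.1.1 i = q.2.1 i} := by ext q; simp
    change IsClosed {q : markovSpace A × markovSpace A | ∀ i < J, q.1.1 i = q.2.1 i}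
    rw [this]
    exact isClosed_iInter fun i => isClosed_iInter fun _ =>
      isClosed_eq
        ((continuous_apply i).comp (continuous_subtype_val.comp continuous_fst))
        ((continuous_apply i).comp (continuous_subtype_val.comp continuous_snd))
  obtain ⟨⟨x, y⟩, hq⟩ := IsCompact.nonempty_iInter_of_sequence_nonempty_isCompact_isClosed D
    (fun J q hq => ⟨fun i hi => hq.1 i (by omega), hq.2⟩)
    (fun J => by
      obtain ⟨x, y, h1, h2⟩ := hcon J
      exact ⟨(x, y), h1, h2.le⟩) (hclosed 0).isCompact hclosed
  rw [Set.mem_iInter] at hq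
  have hxy : x = y := Subtype.ext (funext fun i => (hq (i + 1)).1 i (by omega))
  have := (hq 0).2
  subst hxy
  change f x + η ≤ f x at this
  linarith

theorem shiftDist_le_pow {β : ℝ} (h0 : 0 < β) (h1 : β < 1) {x y : markovSpace A} {N : ℕ}
    (h : ∀ i < N, x.1 i = y.1 i) : shiftDist β x y ≤ β ^ N := by
  rw [shiftDist]
  split_ifs with hxy
  · positivity
  · have hne : x.1 ≠ y.1 := fun h => hxy (Subtype.ext h)
    exact pow_le_pow_of_le_one h0.le h1.le ((PiNat.mem_cylinder_iff_le_firstDiff hne N).1 h)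

theorem shiftDist_nonneg {β : ℝ} (h0 : 0 < β) (x y : markovSpace A) : 0 ≤ shiftDist β x y := by
  rw [shiftDist]
  split_ifs <;> positivity

theorem IsHolder.exists_geometric_variation {β : ℝ} {φ : markovSpace A → ℝ} (hφ : IsHolder β φ)
    (h0 : 0 < β) (h1 : β < 1) : ∃ K ρ : ℝ, 0 < K ∧ 0 < ρ ∧ ρ < 1 ∧ ∀ (N : ℕ) (x y : markovSpace A),
      (∀ i < N, x.1 i = y.1 i) → φ x ≤ φ y + K * ρ ^ N := by
  obtain ⟨K, α, hK, hα, h⟩ := hφ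
  refine ⟨K, β ^ α, hK, by positivity, Real.rpow_lt_one h0.le h1 hα, fun N x y hxy => ?_⟩
  have e1 := le_of_abs_le (h x y)
  have e2 := Real.rpow_le_rpow (shiftDist_nonneg h0 x y) (shiftDist_le_pow h0 h1 hxy) hα.le
  rw [← Real.rpow_natCast, ← Real.rpow_mul h0.le, mul_comm (N : ℝ) α, Real.rpow_mul h0.le,
    Real.rpow_natCast] at e2
  have := mul_le_mul_of_nonneg_left e2 hK.le
  linarith

theorem realOp_le_of_agree (φ f g : C(markovSpace A, ℝ)) (hg : 0 ≤ g) {v : ℝ} {N : ℕ}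
    (hv : ∀ x y : markovSpace A, (∀ i < N + 2, x.1 i = y.1 i) → φ x ≤ φ y + v)
    (hfg : ∀ x y : markovSpace A, (∀ i < N + 2, x.1 i = y.1 i) → f x ≤ g y)
    (x y : markovSpace A) (hxy : ∀ i < N + 1, x.1 i = y.1 i) :
    realOp φ f x ≤ Real.exp v * realOp φ g y := by
  rw [realOp_apply, realOp_apply, Finset.mul_sum]
  refine Finset.sum_le_sum fun i _ => ?_
  by_cases h : A i (x.1 0) = 1
  · have h' : A i (y.1 0) = 1 := by rwa [← hxy 0 (by omega)]
    rw [dif_pos h, dif_pos h']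
    have hag : ∀ k < N + 2, (cons i x h).1 k = (cons i y h').1 k := fun k hk => by
      cases k with
      | zero => rfl
      | succ k => exact hxy k (by omega)
    calc Real.exp (φ (cons i x h)) * f (cons i x h)
        ≤ Real.exp (φ (cons i x h)) * g (cons i y h') :=
          mul_le_mul_of_nonneg_left (hfg _ _ hag) (Real.exp_pos _).le
      _ ≤ Real.exp (φ (cons i y h') + v) * g (cons i y h') :=
          mul_le_mul_of_nonneg_right (Real.exp_le_exp.2 (hv _ _ hag)) (hg _)
      _ = _ := by rw [Real.exp_add]; ring
  · have h' : ¬ A i (y.1 0) = 1 := by rwa [← hxy 0 (by omega)]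
    rw [dif_neg h, dif_neg h', mul_zero]

/-- Bounded distortion. Matching `j`-th preimages of `x` and `y` agree in `j + 1` places, and their
Birkhoff sums of `φ` differ by at most a geometric series, so the constant does not depend on `j`.
-/
theorem realOp_pow_le_of_agree (φ : C(markovSpace A, ℝ)) {K ρ : ℝ} (hK : 0 < K) (h0 : 0 < ρ)
    (h1 : ρ < 1)
    (hv : ∀ (N : ℕ) (x y : markovSpace A), (∀ i < N, x.1 i = y.1 i) → φ x ≤ φ y + K * ρ ^ N)
    (j : ℕ) (f g : C(markovSpace A, ℝ)) (hg : 0 ≤ g)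
    (hfg : ∀ x y : markovSpace A, (∀ i < j + 1, x.1 i = y.1 i) → f x ≤ g y)
    (x y : markovSpace A) (hxy : x.1 0 = y.1 0) :
    (realOp φ ^ j) f x ≤ Real.exp (K * (1 - ρ)⁻¹) * (realOp φ ^ j) g y := by
  have key : (realOp φ ^ j) f x ≤
      Real.exp (K * ∑ i ∈ Finset.range j, ρ ^ i) * (realOp φ ^ j) g y := by
    induction j generalizing f g with
    | zero =>
      simp only [Finset.range_zero, Finset.sum_empty, mul_zero, Real.exp_zero, one_mul, pow_zero,
        Module.End.one_apply]
      exact hfg x y fun i hi => by rwa [Nat.lt_one_iff.1 hi]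
    | succ j ih =>
      rw [pow_succ, Module.End.mul_apply, Module.End.mul_apply]
      -- One application of the operator lowers the required agreement from `j + 2` to `j + 1`
      -- places; its distortion factor is absorbed into the new upper function.
      have := ih (realOp φ f) (Real.exp (K * ρ ^ j) • realOp φ g)
        (smul_nonneg (Real.exp_pos _).le (realOp_nonneg φ g hg))
        (realOp_le_of_agree φ f g hg (fun x y h => (hv _ x y h).trans (by
          have : ρ ^ (j + 2) ≤ ρ ^ j := pow_le_pow_of_le_one h0.le h1.le (by omega)
          gcongr)) hfg)
      rw [map_smul, ContinuousMap.smul_apply, smul_eq_mul, ← mul_assoc, ← Real.exp_add] at this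
      rwa [Finset.sum_range_succ, mul_add]
  refine key.trans (mul_le_mul_of_nonneg_right (Real.exp_le_exp.2 ?_)
    (realOp_pow_nonneg φ g hg j y))
  refine mul_le_mul_of_nonneg_left ?_ hK.le
  rw [← tsum_geometric_of_lt_one h0.le h1]
  exact (summable_geometric_of_lt_one h0.le h1).sum_le_tsum _ fun i _ => by positivity

theorem isMixing_realOp (hA : ∀ i j, A i j = 0 ∨ A i j = 1)
    (hpos : ∃ m : ℕ, 0 < m ∧ ∀ i j, 0 < (A ^ m) i j) {β : ℝ} (hβ0 : 0 < β) (hβ1 : β < 1)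
    (φ : C(markovSpace A, ℝ)) (hφ : IsHolder β φ) : IsMixing (realOp φ) where
  nonneg := realOp_nonneg φ
  one_lower := by
    refine ⟨Real.exp (-‖φ‖), Real.exp_pos _, fun x => ?_⟩
    obtain ⟨i, hi⟩ := exists_predecessor hA hpos (x.1 0)
    exact exp_mul_le_realOp φ 1 zero_le_one x i hi
  mixing := by
    obtain ⟨K, ρ, hK, h0, h1, hv⟩ := hφ.exists_geometric_variation hβ0 hβ1
    obtain ⟨m, -, hm⟩ := hpos
    set E := Real.exp (K * (1 - ρ)⁻¹) with hE
    have hE0 : 0 < E := Real.exp_pos _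
    set b := Real.exp (-‖φ‖) ^ m with hb
    have hb0 : 0 < b := pow_pos (Real.exp_pos _) m
    refine ⟨m, b / E, by positivity, fun f hf η hη => ?_⟩
    -- One factor `E` comes from moving `f + δ` from `y` to `z`, the other from moving `T^j 1` back
    -- from `z` to `y`.
    set δ := η / (E * E) with hδ
    have hδ0 : 0 < δ := by positivity
    obtain ⟨J, hJ⟩ := exists_le_add_of_agree f hδ0
    refine ⟨J, fun j hj x y => ?_⟩
    obtain ⟨z, hz, hle⟩ := exists_mul_le_realOp_pow hA φ ((realOp φ ^ j) f)
      (realOp_pow_nonneg φ f hf j) m (y.1 0) x (hm _ _)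
    rw [← Module.End.mul_apply, ← pow_add, add_comm m j] at hle
    have e1 := realOp_pow_le_of_agree φ hK h0 h1 hv j f (f + δ • 1)
      (add_nonneg hf (smul_nonneg hδ0.le zero_le_one))
      (fun x y h => by simpa using hJ x y fun i hi => h i (by omega)) y z hz.symm
    have e2 := realOp_pow_le_of_agree φ hK h0 h1 hv j 1 1 zero_le_one
      (fun x y _ => le_rfl) z y hz
    rw [map_add, map_smul, ContinuousMap.add_apply, ContinuousMap.smul_apply, smul_eq_mul] at e1
    have e3 : (realOp φ ^ j) f y - η * (realOp φ ^ j) 1 y ≤ E * (realOp φ ^ j) f z := by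
      have h2 := mul_le_mul_of_nonneg_left e2 (mul_pos hE0 hδ0).le
      have h3 : E * δ * (E * (realOp φ ^ j) 1 y) = η * (realOp φ ^ j) 1 y := by
        rw [hδ]; field_simp
      linarith
    calc b / E * ((realOp φ ^ j) f y - η * (realOp φ ^ j) 1 y)
        ≤ b / E * (E * (realOp φ ^ j) f z) := mul_le_mul_of_nonneg_left e3 (by positivity)
      _ = b * (realOp φ ^ j) f z := by field_simp
      _ ≤ _ := hle

end MarkovShift
end

/-! ### Eigenmeasures: Riesz representation and uniqueness -/

noncomputable section

namespace MarkovShift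

open Filter Topology MeasureTheory

theorem exists_probabilityMeasure_integral_eq {X : Type*} [TopologicalSpace X] [CompactSpace X]
    [T2Space X] [MeasurableSpace X] [BorelSpace X] (l : C(X, ℝ) →ₗ[ℝ] ℝ)
    (hl : ∀ f, 0 ≤ f → 0 ≤ l f) (h1 : l 1 = 1) :
    ∃ ν : ProbabilityMeasure X, ∀ g : C(X, ℝ), ∫ x, g x ∂(ν : Measure X) = l g := by
  let Λ : CompactlySupportedContinuousMap X ℝ →ₚ[ℝ] ℝ := PositiveLinearMap.mk₀
    { toFun := fun f => l f.toContinuousMap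
      map_add' := fun f g => l.map_add f.toContinuousMap g.toContinuousMap
      map_smul' := fun r f => l.map_smul r f.toContinuousMap }
    fun f hf => hl f.toContinuousMap hf
  have hΛ : ∀ g : C(X, ℝ), ∫ x, g x ∂(RealRMK.rieszMeasure Λ) = l g := fun g =>
    RealRMK.integral_rieszMeasure Λ (CompactlySupportedContinuousMap.continuousMapEquiv g)
  refine ⟨⟨RealRMK.rieszMeasure Λ, ⟨?_⟩⟩, hΛ⟩
  have h2 := hΛ 1
  rw [h1] at h2
  simp only [ContinuousMap.one_apply, integral_const, smul_eq_mul, mul_one] at h2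
  -- Real mass `1` also excludes infinite total mass, since `∞` has real value `0`.
  rw [← ENNReal.toReal_eq_one_iff]
  exact h2

namespace IsMixing

variable {X : Type*} [TopologicalSpace X] [CompactSpace X] [Nonempty X]
  {T : C(X, ℝ) →ₗ[ℝ] C(X, ℝ)}

/-- Integrating `|T^k g - ratio g * T^k 1| ≤ ε * T^k 1` turns each power `T^k` into the factor `r ^
k`, which cancels. -/
theorem integral_eq_ratio (hT : IsMixing T) [MeasurableSpace X] [BorelSpace X]
    (ν : ProbabilityMeasure X) {r : ℝ}
    (hν : ∀ g : C(X, ℝ), ∫ x, T g x ∂(ν : Measure X) = r * ∫ x, g x ∂(ν : Measure X))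
    (g : C(X, ℝ)) : ∫ x, g x ∂(ν : Measure X) = hT.ratio g := by
  have hint : ∀ f : C(X, ℝ), Integrable f (ν : Measure X) := fun f =>
    f.continuous.integrable_of_hasCompactSupport (HasCompactSupport.of_compactSpace f)
  have hpow : ∀ (k : ℕ) (f : C(X, ℝ)),
      ∫ x, (T ^ k) f x ∂(ν : Measure X) = r ^ k * ∫ x, f x ∂(ν : Measure X) := by
    intro k
    induction k with
    | zero => simp
    | succ k ih =>
      intro f
      rw [pow_succ, Module.End.mul_apply, ih, hν, pow_succ, mul_assoc]
  have hone : ∫ x, (1 : C(X, ℝ)) x ∂(ν : Measure X) = 1 := by simp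
  -- Testing on `1` gives `r = ∫ T 1 dν ≥ p`.
  have hr : 0 < r := by
    obtain ⟨p, hp, h⟩ := hT.one_lower
    have h1 := integral_mono (hint (p • 1)) (hint (T 1)) h
    have h2 : ∫ x, (p • (1 : C(X, ℝ))) x ∂(ν : Measure X) = p := by simp
    rw [hν, hone, h2, mul_one] at h1
    linarith
  refine eq_of_forall_dist_le fun ε hε => ?_
  obtain ⟨k, hk⟩ := hT.ratio_spec g hε
  have h1 := norm_integral_le_of_norm_le
    (f := fun x => (T ^ k) g x - hT.ratio g * (T ^ k) 1 x) (μ := (ν : Measure X))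
    ((hint ((T ^ k) 1)).const_mul ε) (Eventually.of_forall fun x => hk k le_rfl x)
  rw [integral_sub (hint _) ((hint _).const_mul _), integral_const_mul, integral_const_mul, hpow,
    hpow, hone, mul_one, mul_comm _ (r ^ k), ← mul_sub, norm_mul,
    Real.norm_of_nonneg (pow_pos hr k).le, mul_comm ε] at h1
  exact le_of_mul_le_mul_left h1 (pow_pos hr k)

end IsMixing

variable {n : ℕ} {A : Matrix (Fin n) (Fin n) ℕ}

theorem functional_toComplex (ν : ProbabilityMeasure (markovSpace A)) (g : C(markovSpace A, ℝ)) :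
    functional ν (toComplex g) = ((∫ x, g x ∂(ν : Measure (markovSpace A)) : ℝ) : ℂ) :=
  integral_ofReal

theorem eq_toComplex_add (f : C(markovSpace A, ℂ)) : ∃ u v : C(markovSpace A, ℝ),
    f = toComplex u + Complex.I • toComplex v :=
  ⟨⟨fun x => (f x).re, by fun_prop⟩, ⟨fun x => (f x).im, by fun_prop⟩, by
    ext x
    change f x = (f x).re + Complex.I * (f x).im
    rw [mul_comm, Complex.re_add_im]⟩

theorem strongDual_ext_toComplex {F G : StrongDual ℂ C(markovSpace A, ℂ)}
    (h : ∀ g, F (toComplex g) = G (toComplex g)) : F = G := by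
  ext f
  obtain ⟨u, v, rfl⟩ := eq_toComplex_add f
  rw [map_add, map_add, map_smul, map_smul, h, h]

theorem ruelleAdj_functional_toComplex (φ g : C(markovSpace A, ℝ))
    (ν : ProbabilityMeasure (markovSpace A)) : ruelleAdj φ (functional ν) (toComplex g) =
      ((∫ x, realOp φ g x ∂(ν : Measure (markovSpace A)) : ℝ) : ℂ) := by
  change functional ν (ruelleOp φ (toComplex g)) = _
  rw [ruelleOp_toComplex, functional_toComplex]

theorem ruelleAdj_functional_eq_ofReal_smul_iff (φ : C(markovSpace A, ℝ))
    (ν : ProbabilityMeasure (markovSpace A)) (r : ℝ) :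
    ruelleAdj φ (functional ν) = (r : ℂ) • functional ν ↔ ∀ g : C(markovSpace A, ℝ),
      ∫ x, realOp φ g x ∂(ν : Measure (markovSpace A)) =
        r * ∫ x, g x ∂(ν : Measure (markovSpace A)) := by
  constructor
  · intro h g
    have := congrArg (fun F => F (toComplex g)) h
    rw [ruelleAdj_functional_toComplex, smul_apply, functional_toComplex,
      smul_eq_mul] at this
    exact_mod_cast this
  · intro h
    refine strongDual_ext_toComplex fun g => ?_
    rw [ruelleAdj_functional_toComplex, smul_apply, functional_toComplex,
      smul_eq_mul, h]
    push_cast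
    rfl

/-- Evaluation at `1` shows that a complex eigenvalue is automatically real, which reduces the
problem to real functions. -/
theorem eigenvalue_eq_ofReal (φ : C(markovSpace A, ℝ)) (ν : ProbabilityMeasure (markovSpace A))
    (lam : ℂ) (h : ruelleAdj φ (functional ν) = lam • functional ν) :
    lam = ((∫ x, realOp φ 1 x ∂(ν : Measure (markovSpace A)) : ℝ) : ℂ) := by
  rw [← ruelleAdj_functional_toComplex, h, smul_apply, functional_toComplex]
  simp

theorem existsUnique_eigenpair [Nonempty (markovSpace A)] {φ : C(markovSpace A, ℝ)}
    (hT : IsMixing (realOp φ)) : ∃! p : ℂ × ProbabilityMeasure (markovSpace A),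
      ruelleAdj φ (functional p.2) = p.1 • functional p.2 := by
  obtain ⟨ν, hν⟩ := exists_probabilityMeasure_integral_eq
    { toFun := hT.ratio, map_add' := hT.ratio_add, map_smul' := hT.ratio_smul }
    (fun f hf => hT.ratio_nonneg hf) hT.ratio_one
  replace hν : ∀ g : C(markovSpace A, ℝ),
    ∫ x, g x ∂(ν : Measure (markovSpace A)) = hT.ratio g := hν
  refine ⟨((hT.ratio (realOp φ 1) : ℝ), ν), ?_, ?_⟩
  · refine (ruelleAdj_functional_eq_ofReal_smul_iff φ ν _).2 fun g => ?_
    rw [hν, hν, hT.ratio_apply_operator]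
  · rintro ⟨lam, μ⟩ h
    change ruelleAdj φ (functional μ) = lam • functional μ at h
    have hlam := eigenvalue_eq_ofReal φ μ lam h
    rw [hlam, ruelleAdj_functional_eq_ofReal_smul_iff] at h
    have hμ := hT.integral_eq_ratio μ h
    refine Prod.ext ?_ (Subtype.ext ?_)
    · rw [hlam, hμ]
    · refine ext_of_forall_integral_eq_of_IsFiniteMeasure
        (μ := (μ : Measure (markovSpace A))) (ν := (ν : Measure (markovSpace A))) fun f => ?_
      exact (hμ f.toContinuousMap).trans (hν f.toContinuousMap).symm

end MarkovShift
end

open MarkovShift MeasureTheory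
theorem proposition2p3 (n : ℕ) (hn : 0 < n) (A : Matrix (Fin n) (Fin n) ℕ)
    (hA : ∀ i j, A i j = 0 ∨ A i j = 1)
    (hpos : ∃ m : ℕ, 0 < m ∧ ∀ i j, 0 < (A ^ m) i j)
    (β : ℝ) (hβ0 : 0 < β) (hβ1 : β < 1)
    (φ : markovSpace A → ℝ) (hφ : IsHolder β φ) :
    (∃! p : ℂ × ProbabilityMeasure (markovSpace A),
      ruelleAdj ⟨φ, hφ.continuous hβ0 hβ1⟩ (functional p.2) = p.1 • functional p.2) ∧
    (∀ (h h' : C(markovSpace A, ℂ))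
      (ν ν' : ProbabilityMeasure (markovSpace A)) (lam lam' : ℝ),
      IsRuelleTriple ⟨φ, hφ.continuous hβ0 hβ1⟩ h ν lam →
      IsRuelleTriple ⟨φ, hφ.continuous hβ0 hβ1⟩ h' ν' lam' →
      lam = lam' ∧ ν = ν') := by
  have := nonempty_markovSpace hn (exists_successor hA hpos)
  have hex := existsUnique_eigenpair (isMixing_realOp hA hpos hβ0 hβ1 ⟨φ, hφ.continuous hβ0 hβ1⟩ hφ)
  refine ⟨hex, fun h h' ν ν' lam lam' H H' => ?_⟩
  have := hex.unique (y₁ := ((lam : ℂ), ν)) (y₂ := ((lam' : ℂ), ν')) H.eigenmeasure H'.eigenmeasure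
  exact ⟨Complex.ofReal_injective (congrArg Prod.fst this), congrArg Prod.snd this⟩
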